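/- **Setting.** Let $\widetilde{SL_2\mathbf R}$ be the universal cover of $SL(2,\mathbf R)$ in its projective model: homogeneous row vectors $(x^0;x^1;x^2;x^3)$ with $-x^0x^0-x^1x^1+x^2x^2+x^3x^3<0$, up to positive factors, on which matrices act from the right, lifted to the universal cover. The fibre translations are $$\mathbf S(\phi)=\begin{pmatrix}\cos\phi&\sin\phi&0&0\\-\sin\phi&\cos\phi&0&0\\0&0&\cos\phi&-\sin\phi\\0&0&\sin\phi&\cos\phi\end{pmatrix},\qquad \phi\in\mathbf R,$$ and the fibre lines are their orbits. The base plane consists of the points $(1;0;y;z)$ with $y^2+z^2<1$. The rotation by $\omega$ about the fibre line through the origin $(1;0;0;0)$ maps $(x^0;x^1;x^2;x^3)$ to $(x^0;x^1;x^2\cos\omega-x^3\sin\omega;x^2\sin\omega+x^3\cos\omega)$. Its conjugate by the translation $$\mathbf T=\begin{pmatrix}x^0&x^1&x^2&x^3\\-x^1&x^0&x^3&-x^2\\x^2&x^3&x^0&x^1\\x^3&-x^2&-x^1&x^0\end{pmatrix}$$ from the origin to $X=(x^0;x^1;x^2;x^3)$ is the rotation by $\omega$ about the fibre line through $X$. Every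 point is the image under $\mathbf S(\phi)$, for some $\phi\in\mathbf R$, of a base plane point $(1;0;\tanh r\cos\theta;\tanh r\sin\theta)$; in the coordinates $(r,\theta,\phi)$ the invariant metric is $ds^2=dr^2+\cosh^2 r\,\sinh^2 r\,d\theta^2+(d\phi+\sinh^2 r\,d\theta)^2$. Radii of circles in the base plane are measured by the geodesic distance of this metric. **The prism.** Let $p\ge 3$ and $q>\frac{2p}{p-2}$ be integers and $\Psi=2\left(\frac\pi2-\frac\pi p-\frac\pi q\right)$. For $0<b<1$ let $A_1=(1;0;b;0)$ and let $A_2,\dots,A_p$ (indices modulo $p$) be its images under the rotations by the multiples of $\frac{2\pi}p$ about the fibre line through the origin. The $i$-th side surface consists of the fibre lines through the points of the straight segment of the model from $A_i$ to $A_{i+1}\mathbf S(-\Psi/2)$. Its intersection with the base plane is the side curve $c_{A_iA_{i+1}}$. The infinite prism is the solid around the fibre line through the origin that is bounded by the side surfaces, and the base figure is its common part with the base plane. The prism is the tile of the regular infinite prism tiling with parameters $(p,q)$ if the rotation by $\frac{2\pi}q$ about the fibre line $f_1$ through $A_1$ carries the fibre line through $A_2$ to the fibre line through $A_p$ and the side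 surface between $A_1$ and $A_2$ to the side surface between $A_p$ and $A_1$ (so that $q$ prisms meet regularly at each side edge). Its base figure is then denoted by $\mathcal P(p,q)$. **Lemma 4.8.** For all integers $p\ge3$ and $q>\frac{2p}{p-2}$ there is exactly one such $b\in(0,1)$. A circle of radius $r>0$ in the base plane, centred at the origin, is the inscribed circle of $\mathcal P(p,q)$ (it lies in $\mathcal P(p,q)$ together with its interior, no side curve enters its interior, and it touches every side curve in exactly one point) if and only if $$r=r_{opt}(p,q)=\operatorname{artanh}\left(\sqrt{\frac{\cos\frac{\pi}{q}-\sin\frac{\pi}{p}}{\cos\frac{\pi}{q}+\sin\frac{\pi}{p}}}\right).$$ -/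

import Mathlib

open scoped Matrix

noncomputable section

/-! Projective model of the universal cover of `SL(2,ℝ)`. Homogeneous coordinates
`(x⁰, x¹, x², x³)` are row vectors; isometries act by matrices on the right. -/

namespace SL2R

/-- Fibre translation by the parameter `φ`. -/
def fibreTranslation (φ : ℝ) : Matrix (Fin 4) (Fin 4) ℝ :=
  !![Real.cos φ, Real.sin φ, 0, 0;
     -Real.sin φ, Real.cos φ, 0, 0;
     0, 0, Real.cos φ, -Real.sin φ;
     0, 0, Real.sin φ, Real.cos φ]

/-- The translation that maps the origin `(1, 0, 0, 0)` to `x`. -/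
def translation (x : Fin 4 → ℝ) : Matrix (Fin 4) (Fin 4) ℝ :=
  !![x 0, x 1, x 2, x 3;
     -x 1, x 0, x 3, -x 2;
     x 2, x 3, x 0, x 1;
     x 3, -x 2, -x 1, x 0]

/-- Rotation by the angle `ω` about the fibre line through the origin. -/
def originRotation (ω : ℝ) : Matrix (Fin 4) (Fin 4) ℝ :=
  !![1, 0, 0, 0;
     0, 1, 0, 0;
     0, 0, Real.cos ω, Real.sin ω;
     0, 0, -Real.sin ω, Real.cos ω]

/-- Rotation by the angle `ω` about the fibre line through `x`
(used for `x` in the model, where the translation matrix is invertible). -/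
def rotation (x : Fin 4 → ℝ) (ω : ℝ) : Matrix (Fin 4) (Fin 4) ℝ :=
  (translation x)⁻¹ * originRotation ω * translation x

/-- Homogeneous coordinates of the point `(y, z)` of the base plane. -/
def basePoint (y z : ℝ) : Fin 4 → ℝ := ![1, 0, y, z]

/-- The fibre line through `x`: the orbit of `x` under the fibre translations
(with all positive multiples of the homogeneous coordinates). -/
def fibreLine (x : Fin 4 → ℝ) : Set (Fin 4 → ℝ) :=
  {x' | ∃ c : ℝ, 0 < c ∧ ∃ φ : ℝ, x' = c • (x ᵥ* fibreTranslation φ)}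

/-! The space itself in global coordinates `(y, z, φ)`: the point `(y, z, φ)` is the image of the
base plane point `(y, z)`, `y² + z² < 1`, under the fibre translation by `φ ∈ ℝ`. -/

/-- The universal cover of `SL(2,ℝ)`: the product of the unit disc and the line. -/
def space : Set (ℝ × ℝ × ℝ) := {P | P.1 ^ 2 + P.2.1 ^ 2 < 1}

/-- Homogeneous coordinates of the point with global coordinates `(y, z, φ)`. -/
def toProjective (P : ℝ × ℝ × ℝ) : Fin 4 → ℝ :=
  basePoint P.1 P.2.1 ᵥ* fibreTranslation P.2.2

/-- The hyperbolic base plane, in the coordinates `(y, z)`. -/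
def basePlane : Set (ℝ × ℝ) := {A | A.1 ^ 2 + A.2 ^ 2 < 1}

/-- The invariant Riemannian metric (squared length of the tangent vector `v` at `P`). In
coordinates `(r, θ, φ)` with `y = tanh r cos θ`, `z = tanh r sin θ` it is
`dr² + cosh² r sinh² r dθ² + (dφ + sinh² r dθ)²`. -/
def metric (P v : ℝ × ℝ × ℝ) : ℝ :=
  (v.1 ^ 2 + v.2.1 ^ 2) / (1 - P.1 ^ 2 - P.2.1 ^ 2) ^ 2 +
    (v.2.2 + (P.1 * v.2.1 - P.2.1 * v.1) / (1 - P.1 ^ 2 - P.2.1 ^ 2)) ^ 2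

/-- `γ`, restricted to `[0, 1]`, is a continuously differentiable curve in the space
from `P` to `Q`. -/
structure IsCurve (γ : ℝ → ℝ × ℝ × ℝ) (P Q : ℝ × ℝ × ℝ) : Prop where
  contDiff : ContDiff ℝ 1 γ
  mem : ∀ t ∈ Set.Icc (0 : ℝ) 1, γ t ∈ space
  source : γ 0 = P
  target : γ 1 = Q

/-- Length of the curve `γ` on `[0, 1]`. -/
def arcLength (γ : ℝ → ℝ × ℝ × ℝ) : ℝ :=
  ∫ t in (0 : ℝ)..1, √(metric (γ t) (deriv γ t))

/-- Geodesic distance: the infimum of the lengths of the curves that join two points. -/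
def geodesicDist (P Q : ℝ × ℝ × ℝ) : ℝ :=
  sInf {l : ℝ | ∃ γ : ℝ → ℝ × ℝ × ℝ, IsCurve γ P Q ∧ l = arcLength γ}

/-- Geodesic distance of the base plane point `A` from the origin. -/
def distOrigin (A : ℝ × ℝ) : ℝ := geodesicDist (0, 0, 0) (A.1, A.2, 0)

/-- The circle in the base plane with centre the origin and geodesic radius `r`. -/
def circle (r : ℝ) : Set (ℝ × ℝ) := {A | A ∈ basePlane ∧ distOrigin A = r}

/-- The open disc bounded by `circle r`. -/
def openDisc (r : ℝ) : Set (ℝ × ℝ) := {A | A ∈ basePlane ∧ distOrigin A < r}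

/-- The closed disc bounded by `circle r`. -/
def closedDisc (r : ℝ) : Set (ℝ × ℝ) := {A | A ∈ basePlane ∧ distOrigin A ≤ r}

/-! The regular infinite `p`-sided prism centred at the origin. The parameter `b` is the
Euclidean distance of the vertices of the base figure from the origin, in the model. -/

/-- The vertices `A_k` of the base figure (indices modulo `p`): `A_0 = (1; 0; b; 0)` and its
images under the rotations by multiples of `2π/p` about the fibre through the origin. -/
def vertex (p : ℕ) (b : ℝ) (k : ℤ) : Fin 4 → ℝ :=
  basePoint b 0 ᵥ* originRotation (2 * Real.pi * k / p)

/-- The fibre parameter `Ψ = 2 (π/2 - π/p - π/q)` of the translation `τ` in the prism group. -/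
def height (p q : ℕ) : ℝ := 2 * (Real.pi / 2 - Real.pi / p - Real.pi / q)

/-- The segment of the model that joins `A_k` to the point with fibre parameter `-Ψ/2` on the fibre
line through `A_{k+1}`. -/
def sideSegment (p q : ℕ) (b : ℝ) (k : ℤ) : Set (Fin 4 → ℝ) :=
  segment ℝ (vertex p b k) (vertex p b (k + 1) ᵥ* fibreTranslation (-(height p q / 2)))

/-- The side surface between the fibre lines through `A_k` and `A_{k+1}`: it consists of the
fibre lines through the points of the side segment. -/
def sideSurface (p q : ℕ) (b : ℝ) (k : ℤ) : Set (Fin 4 → ℝ) :=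
  ⋃ x ∈ sideSegment p q b k, fibreLine x

/-- The side curve of the base figure from `A_k` to `A_{k+1}`: the foot points in the base plane of
the fibre lines of the side surface. -/
def sideCurve (p q : ℕ) (b : ℝ) (k : ℤ) : Set (ℝ × ℝ) :=
  {A | A ∈ basePlane ∧ basePoint A.1 A.2 ∈ sideSurface p q b k}

/-- The infinite prism: the solid around the central fibre that the side surfaces bound. -/
def infinitePrism (p q : ℕ) (b : ℝ) : Set (ℝ × ℝ × ℝ) :=
  space ∩ closure (connectedComponentIn
    {P | P ∈ space ∧ ∀ k : ℤ, toProjective P ∉ sideSurface p q b k} (0, 0, 0))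

/-- The base figure: the common part of the infinite prism and the base plane. -/
def baseFigure (p q : ℕ) (b : ℝ) : Set (ℝ × ℝ) :=
  {A | (A.1, A.2, (0 : ℝ)) ∈ infinitePrism p q b}

/-- `q` congruent prisms meet regularly at each side edge: the rotation by `2π/q` about the side
fibre line through `A_0` carries the neighbouring side fibre line through `A_1` to the one through
`A_{-1}`, and the side surface between `A_0` and `A_1` to the one between `A_{-1}` and `A_0`.
(The prism is invariant under the rotation by `2π/p` about the central fibre, so the same holds
at the other side edges.) -/
structure IsTilingPrism (p q : ℕ) (b : ℝ) : Prop where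
  pos : 0 < b
  lt_one : b < 1
  edge : (fun x => x ᵥ* rotation (vertex p b 0) (2 * Real.pi / q)) '' fibreLine (vertex p b 1) =
    fibreLine (vertex p b (-1))
  face : (fun x => x ᵥ* rotation (vertex p b 0) (2 * Real.pi / q)) '' sideSurface p q b 0 =
    sideSurface p q b (-1)

/-- The circle of geodesic radius `r` about the origin is the inscribed circle of the base
figure: it lies in the base figure together with its interior, no side curve enters the interior,
and it touches every side curve in exactly one point. -/
structure IsInscribedRadius (p q : ℕ) (b r : ℝ) : Prop where
  pos : 0 < r
  subset : closedDisc r ⊆ baseFigure p q b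
  disjoint : ∀ k : ℤ, Disjoint (openDisc r) (sideCurve p q b k)
  touch : ∀ k : ℤ, ∃! A : ℝ × ℝ, A ∈ circle r ∧ A ∈ sideCurve p q b k

end SL2R

end

/-!
In the complex coordinates `w = x⁰ + i x¹`, `v = x² + i x³` the fibre translation by `φ` is
`(w, v) ↦ (e^{iφ} w, e^{-iφ} v)`, so that `v / w̄` labels the fibre lines by the points of the unit
disc. For the metric at hand this disc is the Poincaré model of the hyperbolic plane of
curvature `-4`. Curves project to the disc without gaining length and radial segments are
horizontal, hence the distance of a base plane point `A` from the origin is `artanh |A|`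
(`distOrigin_eq_artanh`).

Write `P = π / p` and `Q = π / q`. The rotation about a side edge acts on the disc as a Möbius
transformation, and it carries the next vertex to the previous one exactly when
`cos (P + Q) = b² cos (P - Q)`, the relation for the hyperbolic triangle with the angles `P`, `Q`
and `π / 2`. Under this relation the rotation carries `A₁` to the translate of `A₋₁` by `Ψ`, on the
level of homogeneous coordinates (`vertex_one_rotation`); as it commutes with the fibre translations
and is linear, it carries one side segment to a fibre translate of the other one, so that the
condition on the side surfaces follows. This gives `isTilingPrism_iff` and the uniqueness of `b`.

For the point of the side segment with the parameter `t`, the numbers `|w|²` and `|v|²` are affine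
functions of `t (1 - t)`, and the squared distance `|v|² / |w|²` of the foot point from the origin
of the model exceeds `(cos Q - sin P) / (cos Q + sin P)` by a positive multiple of `(1 - 2t)²`
(`sideCurve_sub_inradius_sq`). So every side curve has exactly one point nearest to the origin,
and these points determine the radius. The closed disc lies in the base figure because its radii,
without their end points, miss the side curves and are connected to the origin.
-/

namespace SL2R

open Real

/-! ### Geodesic distance from the origin -/

theorem hasDerivAt_artanh {x : ℝ} (hx : x ^ 2 < 1) :
    HasDerivAt artanh (1 / (1 - x ^ 2)) x := by
  obtain ⟨h1, h2⟩ := abs_lt.1 ((sq_lt_one_iff_abs_lt_one x).1 hx)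
  have hp : 1 + x ≠ 0 := by linarith
  have hm : 1 - x ≠ 0 := by linarith
  have hs : 1 - x ^ 2 ≠ 0 := by linarith
  have key : HasDerivAt (fun x : ℝ => 1 / 2 * (log (1 + x) - log (1 - x)))
      (1 / (1 - x ^ 2)) x := by
    have e := ((((hasDerivAt_id x).const_add 1).log hp).sub
      (((hasDerivAt_id x).const_sub 1).log hm)).const_mul (1 / 2)
    refine e.congr_deriv ?_
    simp only [id]
    field_simp
    ring
  refine key.congr_of_eventuallyEq ?_
  filter_upwards [isOpen_Ioo.mem_nhds (show x ∈ Set.Ioo (-1 : ℝ) 1 from ⟨h1, h2⟩)] with y hy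
  rw [artanh_eq_half_log ⟨hy.1.le, hy.2.le⟩,
    log_div (by linarith [hy.1]) (by linarith [hy.2])]

theorem hasDerivAt_artanh_comp {f : ℝ → ℝ} {f' t : ℝ} (hf : HasDerivAt f f' t)
    (ht : f t ^ 2 < 1) : HasDerivAt (fun t => artanh (f t)) (1 / (1 - f t ^ 2) * f') t :=
  HasDerivAt.comp (h₂ := artanh) t (hasDerivAt_artanh ht) hf

/-- The length element of the metric dominates the derivative of `artanh` along any coordinate
`u₁ y + u₂ z` of the base plane with `u₁² + u₂² ≤ 1`. -/
theorem abs_div_le_sqrt_metric {P v : ℝ × ℝ × ℝ} (hP : P ∈ space) {u₁ u₂ : ℝ}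
    (hu : u₁ ^ 2 + u₂ ^ 2 ≤ 1) :
    |1 / (1 - (P.1 * u₁ + P.2.1 * u₂) ^ 2) * (v.1 * u₁ + v.2.1 * u₂)| ≤ √(metric P v) := by
  apply abs_le_sqrt
  have hP' : P.1 ^ 2 + P.2.1 ^ 2 < 1 := hP
  have hg : (P.1 * u₁ + P.2.1 * u₂) ^ 2 ≤ P.1 ^ 2 + P.2.1 ^ 2 := by
    nlinarith [sq_nonneg (P.1 * u₂ - P.2.1 * u₁), sq_nonneg P.1, sq_nonneg P.2.1]
  have hv : (v.1 * u₁ + v.2.1 * u₂) ^ 2 ≤ v.1 ^ 2 + v.2.1 ^ 2 := by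
    nlinarith [sq_nonneg (v.1 * u₂ - v.2.1 * u₁), sq_nonneg v.1, sq_nonneg v.2.1]
  have hd : 0 < 1 - P.1 ^ 2 - P.2.1 ^ 2 := by linarith
  calc (1 / (1 - (P.1 * u₁ + P.2.1 * u₂) ^ 2) * (v.1 * u₁ + v.2.1 * u₂)) ^ 2
      = (v.1 * u₁ + v.2.1 * u₂) ^ 2 / (1 - (P.1 * u₁ + P.2.1 * u₂) ^ 2) ^ 2 := by
        rw [mul_pow, div_pow, one_pow, one_div_mul_eq_div]
    _ ≤ (v.1 ^ 2 + v.2.1 ^ 2) / (1 - P.1 ^ 2 - P.2.1 ^ 2) ^ 2 := by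
        refine div_le_div₀ (by positivity) hv (by positivity) ?_
        exact pow_le_pow_left₀ hd.le (by linarith) 2
    _ ≤ metric P v := le_add_of_nonneg_right (sq_nonneg _)

theorem artanh_le_arcLength {γ : ℝ → ℝ × ℝ × ℝ} {y z φ : ℝ}
    (h : IsCurve γ (0, 0, 0) (y, z, φ)) : artanh √(y ^ 2 + z ^ 2) ≤ arcLength γ := by
  set R := √(y ^ 2 + z ^ 2) with hR
  have hRsq : R ^ 2 = y ^ 2 + z ^ 2 := sq_sqrt (by positivity)
  -- For `R = 0` the division gives the zero vector, for which the estimate is still correct.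
  have hu : (y / R) ^ 2 + (z / R) ^ 2 ≤ 1 := by
    rw [div_pow, div_pow, ← add_div, ← hRsq]
    exact div_self_le_one _
  have huR : y * (y / R) + z * (z / R) = R := by
    rcases eq_or_ne R 0 with h0 | h0
    · simp [h0]
    · field_simp
      linarith
  have hdiff : ∀ t, HasDerivAt γ (deriv γ t) t := fun t =>
    (h.contDiff.differentiable (by norm_num) t).hasDerivAt
  have hcd : Continuous (deriv γ) := h.contDiff.continuous_deriv (by norm_num)
  have hc : Continuous γ := h.contDiff.continuous
  have hmem : ∀ t ∈ Set.uIcc (0 : ℝ) 1, γ t ∈ space := by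
    rw [Set.uIcc_of_le zero_le_one]
    exact h.mem
  have hsp : ∀ t ∈ Set.uIcc (0 : ℝ) 1, 1 - (γ t).1 ^ 2 - (γ t).2.1 ^ 2 ≠ 0 := fun t ht => by
    have : (γ t).1 ^ 2 + (γ t).2.1 ^ 2 < 1 := hmem t ht
    linarith
  have hg : ∀ t ∈ Set.uIcc (0 : ℝ) 1, ((γ t).1 * (y / R) + (γ t).2.1 * (z / R)) ^ 2 < 1 := by
    intro t ht
    have : (γ t).1 ^ 2 + (γ t).2.1 ^ 2 < 1 := hmem t ht
    nlinarith [sq_nonneg ((γ t).1 * (z / R) - (γ t).2.1 * (y / R)), sq_nonneg (γ t).1,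
      sq_nonneg (γ t).2.1]
  have hderiv : ∀ t ∈ Set.uIcc (0 : ℝ) 1,
      HasDerivAt (fun t => artanh ((γ t).1 * (y / R) + (γ t).2.1 * (z / R)))
        (1 / (1 - ((γ t).1 * (y / R) + (γ t).2.1 * (z / R)) ^ 2) *
          ((deriv γ t).1 * (y / R) + (deriv γ t).2.1 * (z / R))) t := by
    intro t ht
    have h1 : HasDerivAt (fun t => (γ t).1) (deriv γ t).1 t := (hdiff t).fst
    have h2 : HasDerivAt (fun t => (γ t).2.1) (deriv γ t).2.1 t := (hdiff t).snd.fst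
    exact hasDerivAt_artanh_comp ((h1.mul_const (y / R)).add (h2.mul_const (z / R))) (hg t ht)
  have hint : IntervalIntegrable (fun t => 1 / (1 - ((γ t).1 * (y / R) + (γ t).2.1 * (z / R)) ^ 2) *
      ((deriv γ t).1 * (y / R) + (deriv γ t).2.1 * (z / R))) MeasureTheory.volume 0 1 := by
    apply ContinuousOn.intervalIntegrable
    refine ContinuousOn.mul (ContinuousOn.div (by fun_prop) (by fun_prop) fun t ht => ?_)
      (by fun_prop)
    linarith [hg t ht]
  have hint' : IntervalIntegrable (fun t => √(metric (γ t) (deriv γ t)))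
      MeasureTheory.volume 0 1 := by
    apply ContinuousOn.intervalIntegrable
    apply ContinuousOn.sqrt
    unfold metric
    refine ContinuousOn.add (ContinuousOn.div (by fun_prop) (by fun_prop) fun t ht => ?_)
      (ContinuousOn.pow (ContinuousOn.add (by fun_prop)
        (ContinuousOn.div (by fun_prop) (by fun_prop) fun t ht => ?_)) 2)
    · exact pow_ne_zero 2 (hsp t ht)
    · exact hsp t ht
  have hftc := intervalIntegral.integral_eq_sub_of_hasDerivAt hderiv hint
  rw [h.source, h.target] at hftc
  simp only [zero_mul, add_zero, artanh_zero, sub_zero, huR] at hftc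
  rw [← hftc]
  refine intervalIntegral.integral_mono_on zero_le_one hint hint' fun t ht => ?_
  exact (le_abs_self _).trans (abs_div_le_sqrt_metric (h.mem t ht) hu)

theorem isCurve_radial {y z : ℝ} (h : y ^ 2 + z ^ 2 < 1) :
    IsCurve (fun t => (t * y, t * z, 0)) (0, 0, 0) (y, z, 0) where
  contDiff := by fun_prop
  mem t ht := by
    change (t * y) ^ 2 + (t * z) ^ 2 < 1
    have : t ^ 2 ≤ 1 := pow_le_one₀ ht.1 ht.2
    nlinarith [sq_nonneg y, sq_nonneg z]
  source := by simp
  target := by simp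

/-- Radial segments of the base plane are horizontal, that is, orthogonal to the fibres, so that
their length is the length in the hyperbolic base. -/
theorem arcLength_radial {y z : ℝ} (h : y ^ 2 + z ^ 2 < 1) :
    arcLength (fun t => (t * y, t * z, 0)) = artanh √(y ^ 2 + z ^ 2) := by
  set R := √(y ^ 2 + z ^ 2) with hR
  have hRsq : R ^ 2 = y ^ 2 + z ^ 2 := sq_sqrt (by positivity)
  have hR0 : 0 ≤ R := sqrt_nonneg _
  have hlt : ∀ t ∈ Set.uIcc (0 : ℝ) 1, (t * R) ^ 2 < 1 := by
    rw [Set.uIcc_of_le zero_le_one]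
    intro t ht
    have : t ^ 2 ≤ 1 := pow_le_one₀ ht.1 ht.2
    nlinarith [sq_nonneg R]
  have hd : ∀ t, deriv (fun t : ℝ => (t * y, t * z, (0 : ℝ))) t = (y, z, 0) := fun t => by
    have h1 : HasDerivAt (fun t : ℝ => t * y) y t := by simpa using (hasDerivAt_id t).mul_const y
    have h2 : HasDerivAt (fun t : ℝ => t * z) z t := by simpa using (hasDerivAt_id t).mul_const z
    exact (h1.prodMk (h2.prodMk (hasDerivAt_const t (0 : ℝ)))).deriv
  have hderiv : ∀ t ∈ Set.uIcc (0 : ℝ) 1,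
      HasDerivAt (fun t => artanh (t * R)) (1 / (1 - (t * R) ^ 2) * R) t := by
    intro t ht
    have h1 : HasDerivAt (fun t : ℝ => t * R) R t := by simpa using (hasDerivAt_id t).mul_const R
    exact hasDerivAt_artanh_comp h1 (hlt t ht)
  have hint : IntervalIntegrable (fun t => 1 / (1 - (t * R) ^ 2) * R)
      MeasureTheory.volume 0 1 := by
    apply ContinuousOn.intervalIntegrable
    refine ContinuousOn.mul (ContinuousOn.div (by fun_prop) (by fun_prop) fun t ht => ?_)
      (by fun_prop)
    linarith [hlt t ht]
  have hftc := intervalIntegral.integral_eq_sub_of_hasDerivAt hderiv hint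
  simp only [one_mul, zero_mul, artanh_zero, sub_zero] at hftc
  rw [← hftc]
  refine intervalIntegral.integral_congr fun t ht => ?_
  have hpos : 0 < 1 - (t * R) ^ 2 := by linarith [hlt t ht]
  have hm : metric (t * y, t * z, 0) (y, z, 0) = (1 / (1 - (t * R) ^ 2) * R) ^ 2 := by
    have h1 : t * y * z - t * z * y = 0 := by ring
    have h2 : 1 - (t * y) ^ 2 - (t * z) ^ 2 = 1 - (t * R) ^ 2 := by
      rw [mul_pow t R, hRsq]
      ring
    simp only [metric, h1, h2, ← hRsq]
    generalize 1 - (t * R) ^ 2 = d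
    ring
  simp only [hd, hm]
  exact sqrt_sq (by positivity)

/-- The base plane is the Poincaré disc, and the distance from the origin is the hyperbolic one
(for curvature `-4`). -/
theorem distOrigin_eq_artanh {A : ℝ × ℝ} (hA : A ∈ basePlane) :
    distOrigin A = artanh √(A.1 ^ 2 + A.2 ^ 2) := by
  refine le_antisymm (csInf_le ?_ ⟨_, isCurve_radial hA, (arcLength_radial hA).symm⟩)
    (le_csInf ⟨_, _, isCurve_radial hA, rfl⟩ ?_)
  · refine ⟨artanh √(A.1 ^ 2 + A.2 ^ 2), ?_⟩
    rintro _ ⟨γ, hγ, rfl⟩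
    exact artanh_le_arcLength hγ
  · rintro _ ⟨γ, hγ, rfl⟩
    exact artanh_le_arcLength hγ

theorem sqrt_mem_Ioo {A : ℝ × ℝ} (hA : A ∈ basePlane) :
    √(A.1 ^ 2 + A.2 ^ 2) ∈ Set.Ioo (-1 : ℝ) 1 := by
  have h : A.1 ^ 2 + A.2 ^ 2 < 1 := hA
  refine ⟨by linarith [sqrt_nonneg (A.1 ^ 2 + A.2 ^ 2)], ?_⟩
  rw [sqrt_lt' one_pos]
  linarith

theorem distOrigin_lt_artanh_sqrt {A : ℝ × ℝ} (hA : A ∈ basePlane) {s : ℝ}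
    (h1 : s < 1) : distOrigin A < artanh √s ↔ A.1 ^ 2 + A.2 ^ 2 < s := by
  have hs : √s ∈ Set.Ioo (-1 : ℝ) 1 :=
    ⟨by linarith [sqrt_nonneg s], by rw [sqrt_lt' one_pos]; linarith⟩
  rw [distOrigin_eq_artanh hA, artanh_lt_artanh_iff (sqrt_mem_Ioo hA) hs,
    sqrt_lt_sqrt_iff (by positivity)]

theorem distOrigin_le_artanh_sqrt {A : ℝ × ℝ} (hA : A ∈ basePlane) {s : ℝ} (h0 : 0 ≤ s)
    (h1 : s < 1) : distOrigin A ≤ artanh √s ↔ A.1 ^ 2 + A.2 ^ 2 ≤ s := by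
  have hs : √s ∈ Set.Ioo (-1 : ℝ) 1 :=
    ⟨by linarith [sqrt_nonneg s], by rw [sqrt_lt' one_pos]; linarith⟩
  rw [distOrigin_eq_artanh hA, artanh_le_artanh_iff (sqrt_mem_Ioo hA) hs,
    sqrt_le_sqrt_iff h0]

theorem distOrigin_eq_artanh_sqrt {A : ℝ × ℝ} (hA : A ∈ basePlane) {s : ℝ} (h0 : 0 ≤ s)
    (h1 : s < 1) : distOrigin A = artanh √s ↔ A.1 ^ 2 + A.2 ^ 2 = s := by
  rw [eq_iff_le_not_lt, eq_iff_le_not_lt, distOrigin_le_artanh_sqrt hA h0 h1,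
    distOrigin_lt_artanh_sqrt hA h1]

/-! ### Complex coordinates and fibre lines -/

/-- The first complex coordinate `w = x⁰ + i x¹`, on which the fibre translation by `φ` is
multiplication by `e^{iφ}`. -/
def coordW (x : Fin 4 → ℝ) : ℂ := ⟨x 0, x 1⟩

/-- The second complex coordinate `v = x² + i x³`, on which the fibre translation by `φ` is
multiplication by `e^{-iφ}`. -/
def coordV (x : Fin 4 → ℝ) : ℂ := ⟨x 2, x 3⟩

theorem ext_coord {x x' : Fin 4 → ℝ} (hw : coordW x = coordW x') (hv : coordV x = coordV x') :
    x = x' := by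
  have h0 : x 0 = x' 0 := congrArg Complex.re hw
  have h1 : x 1 = x' 1 := congrArg Complex.im hw
  have h2 : x 2 = x' 2 := congrArg Complex.re hv
  have h3 : x 3 = x' 3 := congrArg Complex.im hv
  ext i
  fin_cases i
  exacts [h0, h1, h2, h3]

theorem coordW_smul (c : ℝ) (x : Fin 4 → ℝ) : coordW (c • x) = c * coordW x := by
  apply Complex.ext <;> simp [coordW]

theorem coordV_smul (c : ℝ) (x : Fin 4 → ℝ) : coordV (c • x) = c * coordV x := by
  apply Complex.ext <;> simp [coordV]

theorem coordW_add (x x' : Fin 4 → ℝ) : coordW (x + x') = coordW x + coordW x' := by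
  apply Complex.ext <;> simp [coordW]

theorem coordV_add (x x' : Fin 4 → ℝ) : coordV (x + x') = coordV x + coordV x' := by
  apply Complex.ext <;> simp [coordV]

theorem coordW_basePoint (y z : ℝ) : coordW (basePoint y z) = 1 := by
  apply Complex.ext <;> simp [coordW, basePoint]

theorem coordV_basePoint (y z : ℝ) : coordV (basePoint y z) = ⟨y, z⟩ := by
  apply Complex.ext <;> simp [coordV, basePoint]

theorem coordW_fibreTranslation (x : Fin 4 → ℝ) (φ : ℝ) :
    coordW (x ᵥ* fibreTranslation φ) = coordW x * Complex.exp (φ * Complex.I) := by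
  apply Complex.ext <;>
    simp [coordW, fibreTranslation, Matrix.vecMul, dotProduct, Fin.sum_univ_four,
      Complex.exp_ofReal_mul_I_re, Complex.exp_ofReal_mul_I_im]
  ring

theorem coordV_fibreTranslation (x : Fin 4 → ℝ) (φ : ℝ) :
    coordV (x ᵥ* fibreTranslation φ) = coordV x * Complex.exp ((-φ : ℝ) * Complex.I) := by
  apply Complex.ext <;>
    simp only [Complex.mul_re, Complex.mul_im, Complex.exp_ofReal_mul_I_re,
      Complex.exp_ofReal_mul_I_im, cos_neg, sin_neg] <;>
    simp [coordV, fibreTranslation, Matrix.vecMul, dotProduct, Fin.sum_univ_four]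

theorem coordW_originRotation (x : Fin 4 → ℝ) (ω : ℝ) :
    coordW (x ᵥ* originRotation ω) = coordW x := by
  apply Complex.ext <;>
    simp [coordW, originRotation, Matrix.vecMul, dotProduct, Fin.sum_univ_four]

theorem coordV_originRotation (x : Fin 4 → ℝ) (ω : ℝ) :
    coordV (x ᵥ* originRotation ω) = coordV x * Complex.exp (ω * Complex.I) := by
  apply Complex.ext <;>
    simp [coordV, originRotation, Matrix.vecMul, dotProduct, Fin.sum_univ_four,
      Complex.exp_ofReal_mul_I_re, Complex.exp_ofReal_mul_I_im]
  ring

theorem coordW_translation (x X : Fin 4 → ℝ) : coordW (x ᵥ* translation X) =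
    coordW x * coordW X + starRingEnd ℂ (coordV x) * coordV X := by
  apply Complex.ext <;>
    simp [coordW, coordV, translation, Matrix.vecMul, dotProduct, Fin.sum_univ_four] <;> ring

theorem coordV_translation (x X : Fin 4 → ℝ) : coordV (x ᵥ* translation X) =
    starRingEnd ℂ (coordW x) * coordV X + coordV x * coordW X := by
  apply Complex.ext <;>
    simp [coordW, coordV, translation, Matrix.vecMul, dotProduct, Fin.sum_univ_four] <;> ring

theorem mem_fibreLine_self (x : Fin 4 → ℝ) : x ∈ fibreLine x := by
  refine ⟨1, one_pos, 0, ext_coord ?_ ?_⟩ <;>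
    simp [coordW_fibreTranslation, coordV_fibreTranslation]

theorem fibreTranslation_vecMul_add (x : Fin 4 → ℝ) (φ ψ : ℝ) :
    x ᵥ* fibreTranslation (φ + ψ) = (x ᵥ* fibreTranslation φ) ᵥ* fibreTranslation ψ := by
  apply ext_coord
  · simp only [coordW_fibreTranslation, mul_assoc, ← Complex.exp_add]
    push_cast
    ring_nf
  · simp only [coordV_fibreTranslation, mul_assoc, ← Complex.exp_add]
    push_cast
    ring_nf

theorem fibreLine_fibreTranslation (x : Fin 4 → ℝ) (φ : ℝ) :
    fibreLine (x ᵥ* fibreTranslation φ) = fibreLine x := by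
  ext x'
  constructor
  · rintro ⟨c, hc, ψ, h⟩
    exact ⟨c, hc, φ + ψ, by rw [h, fibreTranslation_vecMul_add]⟩
  · rintro ⟨c, hc, ψ, h⟩
    exact ⟨c, hc, -φ + ψ, by rw [h, ← fibreTranslation_vecMul_add, add_neg_cancel_left]⟩

/-- The foot point `v / w̄` is the same for all points of a fibre line. -/
theorem coordV_mul_conj_of_mem_fibreLine {x x' : Fin 4 → ℝ} (h : x' ∈ fibreLine x) :
    coordV x' * starRingEnd ℂ (coordW x) = coordV x * starRingEnd ℂ (coordW x') := by
  obtain ⟨c, -, φ, rfl⟩ := h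
  simp only [coordW_smul, coordV_smul, coordW_fibreTranslation, coordV_fibreTranslation, map_mul,
    Complex.conj_ofReal, ← Complex.exp_conj, Complex.conj_I, Complex.ofReal_neg, neg_mul, mul_neg]
  ring

theorem basePoint_mem_fibreLine_iff {x : Fin 4 → ℝ} (hx : coordW x ≠ 0) (y z : ℝ) :
    basePoint y z ∈ fibreLine x ↔ (⟨y, z⟩ : ℂ) * starRingEnd ℂ (coordW x) = coordV x := by
  constructor
  · intro h
    have := coordV_mul_conj_of_mem_fibreLine h
    simpa [coordV_basePoint, coordW_basePoint] using this
  · intro h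
    have hn : (‖coordW x‖ : ℂ) ≠ 0 := by simpa using hx
    have he : (‖coordW x‖ : ℂ) * Complex.exp (Complex.arg (coordW x) * Complex.I) = coordW x :=
      Complex.norm_mul_exp_arg_mul_I _
    refine ⟨‖coordW x‖⁻¹, by positivity, -Complex.arg (coordW x), ext_coord ?_ ?_⟩
    · rw [coordW_smul, coordW_fibreTranslation, coordW_basePoint]
      nth_rw 2 [← he]
      rw [mul_assoc, ← Complex.exp_add]
      push_cast
      rw [neg_mul, add_neg_cancel, Complex.exp_zero, mul_one, inv_mul_cancel₀ hn]
    · rw [coordV_smul, coordV_fibreTranslation, coordV_basePoint, neg_neg, ← h]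
      nth_rw 2 [← he]
      rw [map_mul, ← Complex.exp_conj, map_mul, Complex.conj_ofReal, Complex.conj_ofReal,
        Complex.conj_I, mul_assoc, mul_assoc, ← Complex.exp_add]
      push_cast
      rw [mul_neg, neg_add_cancel, Complex.exp_zero, mul_one, mul_left_comm, inv_mul_cancel₀ hn,
        mul_one]

/-! ### The rotation about a side edge -/

theorem translation_basePoint_inv {b : ℝ} (hb : 1 - b ^ 2 ≠ 0) :
    (translation (basePoint b 0))⁻¹ = (1 - b ^ 2)⁻¹ • translation (basePoint (-b) 0) := by
  apply Matrix.inv_eq_right_inv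
  rw [Matrix.mul_smul]
  ext i j
  fin_cases i <;> fin_cases j <;>
    simp [translation, basePoint] <;> field_simp <;> ring

theorem coordW_rotation {b : ℝ} (hb : 1 - b ^ 2 ≠ 0) (x : Fin 4 → ℝ) (ω : ℝ) :
    coordW (x ᵥ* rotation (basePoint b 0) ω) = (1 - b ^ 2 : ℂ)⁻¹ *
      (coordW x * (1 - b ^ 2 * Complex.exp ((-ω : ℝ) * Complex.I)) -
        b * starRingEnd ℂ (coordV x) * (1 - Complex.exp ((-ω : ℝ) * Complex.I))) := by
  have hbc : (⟨b, 0⟩ : ℂ) = b := rfl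
  have hbn : (⟨-b, 0⟩ : ℂ) = -b := by apply Complex.ext <;> simp
  rw [rotation, translation_basePoint_inv hb, ← Matrix.vecMul_vecMul, ← Matrix.vecMul_vecMul,
    Matrix.vecMul_smul]
  simp only [coordW_translation, coordW_originRotation, coordV_originRotation, coordV_translation,
    coordW_smul, coordV_smul, coordW_basePoint, coordV_basePoint, hbc, hbn, map_mul, map_add,
    map_neg, map_one, Complex.conj_conj, Complex.conj_ofReal, ← Complex.exp_conj, Complex.conj_I]
  push_cast
  ring_nf

theorem coordV_rotation {b : ℝ} (hb : 1 - b ^ 2 ≠ 0) (x : Fin 4 → ℝ) (ω : ℝ) :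
    coordV (x ᵥ* rotation (basePoint b 0) ω) = (1 - b ^ 2 : ℂ)⁻¹ *
      (coordV x * (Complex.exp (ω * Complex.I) - b ^ 2) +
        b * starRingEnd ℂ (coordW x) * (1 - Complex.exp (ω * Complex.I))) := by
  have hbc : (⟨b, 0⟩ : ℂ) = b := rfl
  have hbn : (⟨-b, 0⟩ : ℂ) = -b := by apply Complex.ext <;> simp
  rw [rotation, translation_basePoint_inv hb, ← Matrix.vecMul_vecMul, ← Matrix.vecMul_vecMul,
    Matrix.vecMul_smul]
  simp only [coordW_translation, coordW_originRotation, coordV_originRotation, coordV_translation,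
    coordW_smul, coordV_smul, coordW_basePoint, coordV_basePoint, hbc, hbn, map_mul, map_add,
    map_neg, map_one, Complex.conj_conj, Complex.conj_ofReal]
  push_cast
  ring

theorem rotation_fibreTranslation {b : ℝ} (hb : 1 - b ^ 2 ≠ 0) (x : Fin 4 → ℝ) (ω φ : ℝ) :
    (x ᵥ* fibreTranslation φ) ᵥ* rotation (basePoint b 0) ω =
      (x ᵥ* rotation (basePoint b 0) ω) ᵥ* fibreTranslation φ := by
  apply ext_coord
  · simp only [coordW_rotation hb, coordW_fibreTranslation,
      coordV_fibreTranslation, map_mul, ← Complex.exp_conj, Complex.conj_ofReal, Complex.conj_I]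
    push_cast
    ring_nf
  · simp only [coordV_rotation hb, coordW_fibreTranslation,
      coordV_fibreTranslation, map_mul, ← Complex.exp_conj, Complex.conj_ofReal, Complex.conj_I]
    push_cast
    ring_nf

theorem rotation_basePoint_self {b : ℝ} (hb : 1 - b ^ 2 ≠ 0) (ω : ℝ) :
    basePoint b 0 ᵥ* rotation (basePoint b 0) ω = basePoint b 0 := by
  have hbc : (⟨b, 0⟩ : ℂ) = b := rfl
  have hb' : (1 - b ^ 2 : ℂ) ≠ 0 := by exact_mod_cast hb
  apply ext_coord
  · rw [coordW_rotation hb, coordW_basePoint, coordV_basePoint, hbc, Complex.conj_ofReal]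
    field_simp
    ring
  · rw [coordV_rotation hb, coordW_basePoint, coordV_basePoint, hbc, map_one]
    field_simp
    ring

theorem image_rotation_fibreLine {b : ℝ} (hb : 1 - b ^ 2 ≠ 0) (x : Fin 4 → ℝ) (ω : ℝ) :
    (fun x => x ᵥ* rotation (basePoint b 0) ω) '' fibreLine x =
      fibreLine (x ᵥ* rotation (basePoint b 0) ω) := by
  ext x'
  constructor
  · rintro ⟨_, ⟨c, hc, φ, rfl⟩, rfl⟩
    exact ⟨c, hc, φ, by
      simp only [Matrix.smul_vecMul, rotation_fibreTranslation hb]⟩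
  · rintro ⟨c, hc, φ, rfl⟩
    exact ⟨_, ⟨c, hc, φ, rfl⟩, by
      simp only [Matrix.smul_vecMul, rotation_fibreTranslation hb]⟩

/-! ### The tiling condition -/

theorem vertex_zero (p : ℕ) (b : ℝ) : vertex p b 0 = basePoint b 0 := by
  apply ext_coord <;> simp [vertex, coordW_originRotation, coordV_originRotation]

theorem coordW_vertex (p : ℕ) (b : ℝ) (k : ℤ) : coordW (vertex p b k) = 1 := by
  rw [vertex, coordW_originRotation, coordW_basePoint]

theorem coordV_vertex (p : ℕ) (b : ℝ) (k : ℤ) :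
    coordV (vertex p b k) = b * Complex.exp ((2 * π * k / p : ℝ) * Complex.I) := by
  rw [vertex, coordV_originRotation, coordV_basePoint]
  rfl

theorem exp_mul_exp_add_one (x y : ℂ) :
    Complex.exp (2 * x * Complex.I) * Complex.exp (2 * y * Complex.I) + 1 =
      Complex.exp ((x + y) * Complex.I) * (2 * Complex.cos (x + y)) := by
  rw [Complex.two_cos, mul_add, ← Complex.exp_add, ← Complex.exp_add, ← Complex.exp_add, neg_mul,
    add_neg_cancel, Complex.exp_zero]
  ring_nf

theorem exp_add_exp (x y : ℂ) :
    Complex.exp (2 * x * Complex.I) + Complex.exp (2 * y * Complex.I) =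
      Complex.exp ((x + y) * Complex.I) * (2 * Complex.cos (x - y)) := by
  rw [Complex.two_cos, mul_add, ← Complex.exp_add, ← Complex.exp_add]
  ring_nf

/-- The algebraic form of the right-angled triangle relation `cos (P + Q) = b² cos (P - Q)`, in
the unit complex numbers with the arguments `2P` and `2Q`. -/
theorem exp_relation_iff (P Q b : ℝ) :
    Complex.exp ((2 * P : ℝ) * Complex.I) * Complex.exp ((2 * Q : ℝ) * Complex.I) + 1 =
        b ^ 2 * (Complex.exp ((2 * P : ℝ) * Complex.I) + Complex.exp ((2 * Q : ℝ) * Complex.I)) ↔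
      cos (P + Q) = b ^ 2 * cos (P - Q) := by
  push_cast
  rw [exp_mul_exp_add_one, exp_add_exp, mul_left_comm (b ^ 2 : ℂ),
    mul_right_inj' (Complex.exp_ne_zero _), mul_left_comm (b ^ 2 : ℂ), mul_right_inj' two_ne_zero]
  norm_cast

section

variable {p q : ℕ} {b : ℝ}

/-- The image of the next vertex under the rotation about a side edge lies on the fibre line of the
previous vertex, at the height `Ψ`. -/
theorem vertex_one_rotation (hb : 1 - b ^ 2 ≠ 0)
    (h : cos (π / p + π / q) = b ^ 2 * cos (π / p - π / q)) :
    vertex p b 1 ᵥ* rotation (vertex p b 0) (2 * π / q) =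
      vertex p b (-1) ᵥ* fibreTranslation (height p q) := by
  have hb' : (1 - b ^ 2 : ℂ) ≠ 0 := by exact_mod_cast hb
  rw [← exp_relation_iff] at h
  have he1 : (2 * π * ((1 : ℤ) : ℝ) / p : ℝ) = 2 * (π / p) := by push_cast; ring
  have he2 : (2 * π * ((-1 : ℤ) : ℝ) / p : ℝ) = -(2 * (π / p)) := by push_cast; ring
  have he3 : (2 * π / q : ℝ) = 2 * (π / q) := by ring
  have he4 : height p q = π - 2 * (π / p) - 2 * (π / q) := by rw [height]; ring
  have hexp (x : ℝ) : Complex.exp ((-x : ℝ) * Complex.I) = (Complex.exp (x * Complex.I))⁻¹ := by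
    rw [Complex.ofReal_neg, neg_mul, Complex.exp_neg]
  have hconj (x : ℝ) : starRingEnd ℂ (Complex.exp (x * Complex.I)) =
      (Complex.exp (x * Complex.I))⁻¹ := by
    rw [← Complex.exp_conj, map_mul, Complex.conj_ofReal, Complex.conj_I, mul_neg, Complex.exp_neg]
  have hpi (x y : ℝ) : Complex.exp ((π - x - y : ℝ) * Complex.I) =
      -((Complex.exp (x * Complex.I))⁻¹ * (Complex.exp (y * Complex.I))⁻¹) := by
    push_cast
    rw [sub_mul, sub_mul, Complex.exp_sub, Complex.exp_sub, Complex.exp_pi_mul_I]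
    field_simp
  have hE := Complex.exp_ne_zero ((2 * (π / q) : ℝ) * Complex.I)
  have he := Complex.exp_ne_zero ((2 * (π / p) : ℝ) * Complex.I)
  rw [vertex_zero]
  apply ext_coord
  · simp only [coordW_rotation hb, coordW_fibreTranslation, coordW_vertex, coordV_vertex, he1, he3,
      he4, hpi, hexp, map_mul, Complex.conj_ofReal, hconj]
    generalize Complex.exp ((2 * (π / q) : ℝ) * Complex.I) = E at *
    generalize Complex.exp ((2 * (π / p) : ℝ) * Complex.I) = e at *
    field_simp
    linear_combination h
  · simp only [coordV_rotation hb, coordV_fibreTranslation, coordW_vertex, coordV_vertex, he1, he2,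
      he3, he4, hpi, hexp, map_one]
    generalize Complex.exp ((2 * (π / q) : ℝ) * Complex.I) = E at *
    generalize Complex.exp ((2 * (π / p) : ℝ) * Complex.I) = e at *
    field_simp
    linear_combination b * h

theorem edge_iff (hp : 3 ≤ p) (hb0 : 0 < b) (hb1 : b < 1) :
    (fun x => x ᵥ* rotation (vertex p b 0) (2 * π / q)) '' fibreLine (vertex p b 1) =
      fibreLine (vertex p b (-1)) ↔ cos (π / p + π / q) = b ^ 2 * cos (π / p - π / q) := by
  have hb : 1 - b ^ 2 ≠ 0 := by nlinarith
  constructor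
  · rw [vertex_zero, image_rotation_fibreLine hb, ← exp_relation_iff]
    intro h
    have hb' : (1 - b ^ 2 : ℂ) ≠ 0 := by exact_mod_cast hb
    have hbc : (b : ℂ) ≠ 0 := by exact_mod_cast hb0.ne'
    have hfoot := coordV_mul_conj_of_mem_fibreLine (h ▸ mem_fibreLine_self _)
    have he1 : (2 * π * ((1 : ℤ) : ℝ) / p : ℝ) = 2 * (π / p) := by push_cast; ring
    have he2 : (2 * π * ((-1 : ℤ) : ℝ) / p : ℝ) = -(2 * (π / p)) := by push_cast; ring
    have he3 : (2 * π / q : ℝ) = 2 * (π / q) := by ring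
    have hexp (x : ℝ) : Complex.exp ((-x : ℝ) * Complex.I) = (Complex.exp (x * Complex.I))⁻¹ := by
      rw [Complex.ofReal_neg, neg_mul, Complex.exp_neg]
    have hconj (x : ℝ) : starRingEnd ℂ (Complex.exp (x * Complex.I)) =
        (Complex.exp (x * Complex.I))⁻¹ := by
      rw [← Complex.exp_conj, map_mul, Complex.conj_ofReal, Complex.conj_I, mul_neg,
        Complex.exp_neg]
    have hE := Complex.exp_ne_zero ((2 * (π / q) : ℝ) * Complex.I)
    have he := Complex.exp_ne_zero ((2 * (π / p) : ℝ) * Complex.I)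
    -- The vertices `A₀` and `A₁` are different.
    have hne : Complex.exp ((2 * (π / p) : ℝ) * Complex.I) ≠ 1 := by
      intro h1
      have h2 := congrArg Complex.re h1
      rw [Complex.exp_ofReal_mul_I_re, Complex.one_re] at h2
      have hp' : (3 : ℝ) ≤ p := by exact_mod_cast hp
      have hpos : 0 < π / p := by positivity
      have hlt : π / p < π := div_lt_self pi_pos (by linarith)
      have := sin_pos_of_pos_of_lt_pi hpos hlt
      rw [cos_two_mul] at h2
      nlinarith [sin_sq_add_cos_sq (π / p)]
    simp only [coordW_rotation hb, coordV_rotation hb, coordW_vertex, coordV_vertex, he1, he2, he3,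
      hexp, map_mul, map_sub, map_one, map_inv₀, map_pow, Complex.conj_ofReal, hconj,
      inv_inv] at hfoot
    generalize Complex.exp ((2 * (π / q) : ℝ) * Complex.I) = E at *
    generalize Complex.exp ((2 * (π / p) : ℝ) * Complex.I) = e at *
    have hne' : e - 1 ≠ 0 := sub_ne_zero.2 hne
    field_simp at hfoot
    apply mul_left_cancel₀ hne'
    linear_combination hfoot
  · intro h
    have h1 := vertex_one_rotation hb h
    rw [vertex_zero] at h1 ⊢
    rw [image_rotation_fibreLine hb, h1, fibreLine_fibreTranslation]

theorem image_vecMul_segment (M : Matrix (Fin 4) (Fin 4) ℝ) (x y : Fin 4 → ℝ) :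
    (fun x => x ᵥ* M) '' segment ℝ x y = segment ℝ (x ᵥ* M) (y ᵥ* M) :=
  image_segment ℝ (Matrix.vecMulLinear M).toAffineMap x y

theorem image_rotation_sideSegment (hb : 1 - b ^ 2 ≠ 0)
    (h : cos (π / p + π / q) = b ^ 2 * cos (π / p - π / q)) :
    (fun x => x ᵥ* rotation (vertex p b 0) (2 * π / q)) '' sideSegment p q b 0 =
      (fun x => x ᵥ* fibreTranslation (height p q / 2)) '' sideSegment p q b (-1) := by
  have h1 := vertex_one_rotation hb h
  have h0 (x : Fin 4 → ℝ) : x ᵥ* fibreTranslation 0 = x := by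
    apply ext_coord <;> simp [coordW_fibreTranslation, coordV_fibreTranslation]
  rw [sideSegment, sideSegment, image_vecMul_segment, image_vecMul_segment, zero_add,
    neg_add_cancel, ← fibreTranslation_vecMul_add, neg_add_cancel, h0, segment_symm]
  congr 1
  · rw [vertex_zero] at h1 ⊢
    rw [rotation_fibreTranslation hb, h1, ← fibreTranslation_vecMul_add]
    congr 2
    ring
  · rw [vertex_zero, rotation_basePoint_self hb]

theorem image_rotation_sideSurface (hb : 1 - b ^ 2 ≠ 0)
    (h : cos (π / p + π / q) = b ^ 2 * cos (π / p - π / q)) :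
    (fun x => x ᵥ* rotation (vertex p b 0) (2 * π / q)) '' sideSurface p q b 0 =
      sideSurface p q b (-1) := by
  have hseg := image_rotation_sideSegment hb h
  have h1 : ∀ x, (fun x => x ᵥ* rotation (vertex p b 0) (2 * π / q)) '' fibreLine x =
      fibreLine (x ᵥ* rotation (vertex p b 0) (2 * π / q)) := fun x => by
    rw [vertex_zero, image_rotation_fibreLine hb]
  calc (fun x => x ᵥ* rotation (vertex p b 0) (2 * π / q)) '' sideSurface p q b 0
      = ⋃ x ∈ (fun x => x ᵥ* rotation (vertex p b 0) (2 * π / q)) '' sideSegment p q b 0,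
          fibreLine x := by
        rw [sideSurface, Set.image_iUnion₂, Set.biUnion_image]
        exact Set.iUnion₂_congr fun x _ => h1 x
    _ = sideSurface p q b (-1) := by
        rw [hseg, sideSurface, Set.biUnion_image]
        exact Set.iUnion₂_congr fun x _ => fibreLine_fibreTranslation x _

theorem isTilingPrism_iff (hp : 3 ≤ p) : IsTilingPrism p q b ↔
    0 < b ∧ b < 1 ∧ cos (π / p + π / q) = b ^ 2 * cos (π / p - π / q) := by
  constructor
  · intro h
    exact ⟨h.pos, h.lt_one, (edge_iff hp h.pos h.lt_one).1 h.edge⟩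
  · rintro ⟨h0, h1, h⟩
    exact ⟨h0, h1, (edge_iff hp h0 h1).2 h, image_rotation_sideSurface (by nlinarith) h⟩

/-! ### The side curves -/

theorem normSq_lineMap_exp (t γ : ℝ) :
    Complex.normSq ((1 - t) + t * Complex.exp (γ * Complex.I)) =
      1 - 2 * (t * (1 - t)) * (1 - cos γ) := by
  rw [Complex.normSq_apply]
  simp only [Complex.add_re, Complex.add_im, Complex.sub_re, Complex.sub_im, Complex.one_re,
    Complex.one_im, Complex.ofReal_re, Complex.ofReal_im, Complex.re_ofReal_mul,
    Complex.im_ofReal_mul, Complex.exp_ofReal_mul_I_re, Complex.exp_ofReal_mul_I_im]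
  linear_combination t ^ 2 * sin_sq_add_cos_sq γ

/-- The point of the side segment from `A_k` with affine parameter `t`. -/
noncomputable def sidePoint (p q : ℕ) (b : ℝ) (k : ℤ) (t : ℝ) : Fin 4 → ℝ :=
  (1 - t) • vertex p b k + t • (vertex p b (k + 1) ᵥ* fibreTranslation (-(height p q / 2)))

theorem coordW_sidePoint (k : ℤ) (t : ℝ) : coordW (sidePoint p q b k t) =
    (1 - t) + t * Complex.exp ((-(height p q / 2) : ℝ) * Complex.I) := by
  simp only [sidePoint, coordW_add, coordW_smul, coordW_fibreTranslation, coordW_vertex]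
  push_cast
  ring

theorem coordV_sidePoint (k : ℤ) (t : ℝ) : coordV (sidePoint p q b k t) =
    b * Complex.exp ((2 * π * k / p : ℝ) * Complex.I) *
      ((1 - t) + t * Complex.exp ((2 * (π / p) + height p q / 2 : ℝ) * Complex.I)) := by
  have h : Complex.exp ((2 * π * ((k + 1 : ℤ) : ℝ) / p : ℝ) * Complex.I) *
      Complex.exp ((height p q / 2 : ℝ) * Complex.I) =
      Complex.exp ((2 * π * k / p : ℝ) * Complex.I) *
        Complex.exp ((2 * (π / p) + height p q / 2 : ℝ) * Complex.I) := by
    rw [← Complex.exp_add, ← Complex.exp_add]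
    congr 1
    push_cast
    ring
  simp only [sidePoint, coordV_add, coordV_smul, coordV_fibreTranslation, coordV_vertex, neg_neg]
  rw [mul_assoc (b : ℂ), h]
  push_cast
  ring

theorem normSq_coordW_sidePoint (k : ℤ) (t : ℝ) :
    Complex.normSq (coordW (sidePoint p q b k t)) =
      1 - 2 * (t * (1 - t)) * (1 - sin (π / p + π / q)) := by
  rw [coordW_sidePoint, normSq_lineMap_exp, cos_neg, ← cos_pi_div_two_sub, height]
  ring_nf

theorem normSq_coordV_sidePoint (k : ℤ) (t : ℝ) :
    Complex.normSq (coordV (sidePoint p q b k t)) =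
      b ^ 2 * (1 - 2 * (t * (1 - t)) * (1 - sin (π / q - π / p))) := by
  have h : sin (π / q - π / p) = cos (2 * (π / p) + height p q / 2) := by
    rw [← cos_pi_div_two_sub, height]
    ring_nf
  rw [coordV_sidePoint, map_mul, map_mul, normSq_lineMap_exp, Complex.normSq_ofReal,
    Complex.normSq_eq_norm_sq, Complex.norm_exp_ofReal_mul_I, h]
  ring

theorem mem_sideCurve_iff {A : ℝ × ℝ} {k : ℤ} : A ∈ sideCurve p q b k ↔ A ∈ basePlane ∧
    ∃ t ∈ Set.Icc (0 : ℝ) 1, basePoint A.1 A.2 ∈ fibreLine (sidePoint p q b k t) := by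
  simp only [sideCurve, sideSurface, sideSegment, segment_eq_image, Set.mem_ofPred_eq,
    Set.mem_iUnion, Set.biUnion_image, exists_prop, sidePoint]

end

/-! ### The inscribed circle -/

theorem angle_bounds {p q : ℕ} (hp : 3 ≤ p) (hq : 2 * (p : ℝ) / ((p : ℝ) - 2) < (q : ℝ)) :
    0 < π / p ∧ 0 < π / q ∧ π / p + π / q < π / 2 := by
  have hp' : (3 : ℝ) ≤ p := by exact_mod_cast hp
  have hp2 : (0 : ℝ) < (p : ℝ) - 2 := by linarith
  have hq' : (0 : ℝ) < q := lt_trans (by positivity) hq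
  rw [div_lt_iff₀ hp2] at hq
  refine ⟨by positivity, by positivity, ?_⟩
  rw [div_add_div _ _ (by positivity) hq'.ne', div_lt_div_iff₀ (by positivity) two_pos]
  nlinarith [pi_pos]

section

variable {P Q b : ℝ}

theorem sin_lt_cos_of_add_lt (hP : 0 < P) (hQ : 0 < Q) (h : P + Q < π / 2) : sin P < cos Q := by
  rw [← cos_pi_div_two_sub]
  exact cos_lt_cos_of_nonneg_of_le_pi_div_two hQ.le (by linarith) (by linarith)

/-- The squared radius of the inscribed circle, in the model, lies strictly between `0` and `1`. -/
theorem inradius_sq_mem_Ioo (hP : 0 < P) (hQ : 0 < Q) (h : P + Q < π / 2) :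
    (cos Q - sin P) / (cos Q + sin P) ∈ Set.Ioo (0 : ℝ) 1 := by
  have h1 := sin_lt_cos_of_add_lt hP hQ h
  have h2 : 0 < sin P := sin_pos_of_pos_of_lt_pi hP (by linarith)
  refine ⟨div_pos (by linarith) (by linarith), ?_⟩
  rw [div_lt_one (by linarith)]
  linarith

/-- The quotient `|v|² / |w|²` at the midpoint of a side segment is
`b² (1 + sin (Q - P)) / (1 + sin (P + Q))`; it agrees with the squared radius. -/
theorem inradius_sq_mul (hP : 0 < P) (hQ : 0 < Q) (h : P + Q < π / 2)
    (hb : cos (P + Q) = b ^ 2 * cos (P - Q)) :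
    (cos Q - sin P) / (cos Q + sin P) * (1 + sin (P + Q)) = b ^ 2 * (1 + sin (Q - P)) := by
  have h1 := sin_lt_cos_of_add_lt hP hQ h
  have h2 : 0 < sin P := sin_pos_of_pos_of_lt_pi hP (by linarith)
  have h3 : 0 < cos (P - Q) := cos_pos_of_mem_Ioo ⟨by linarith, by linarith⟩
  have h4 : 0 < cos Q + sin P := by linarith
  have key : (cos Q - sin P) * (1 + sin (P + Q)) * cos (P - Q) =
      cos (P + Q) * (1 + sin (Q - P)) * (cos Q + sin P) := by
    rw [sin_add, sin_sub, cos_add, cos_sub]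
    linear_combination 2 * sin P * cos Q * cos P * sin_sq_add_cos_sq Q -
      2 * sin P * cos Q * sin Q * sin_sq_add_cos_sq P
  rw [div_mul_eq_mul_div, div_eq_iff h4.ne']
  apply mul_right_cancel₀ h3.ne'
  rw [key, hb]
  ring

theorem sin_sub_lt_sin_add (hP : 0 < P) (hQ : 0 < Q) (h : P + Q < π / 2) :
    sin (Q - P) < sin (P + Q) :=
  sin_lt_sin_of_lt_of_le_pi_div_two (by linarith) h.le (by linarith)

end

section

variable {p q : ℕ} {b : ℝ}

theorem one_add_sin_div_two_le {s t : ℝ} (hs : s ≤ 1) :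
    (1 + s) / 2 ≤ 1 - 2 * (t * (1 - t)) * (1 - s) := by
  nlinarith [mul_nonneg (sub_nonneg.2 hs) (sq_nonneg (2 * t - 1))]

theorem sin_add_pos {P Q : ℝ} (hP : 0 < P) (hQ : 0 < Q) (h : P + Q < π / 2) : 0 < sin (P + Q) :=
  sin_pos_of_pos_of_lt_pi (by linarith) (by linarith)

theorem normSq_coordW_sidePoint_pos (hP : 0 < π / p) (hQ : 0 < π / q)
    (h : π / p + π / q < π / 2) (k : ℤ) (t : ℝ) :
    0 < Complex.normSq (coordW (sidePoint p q b k t)) := by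
  rw [normSq_coordW_sidePoint]
  linarith [one_add_sin_div_two_le (t := t) (sin_le_one (π / p + π / q)), sin_add_pos hP hQ h]

/-- The squared distance of a foot point from the origin exceeds its value at the midpoint of the
side segment by a positive multiple of `(1 - 2t)²`. -/
theorem sideCurve_sub_inradius_sq (hP : 0 < π / p) (hQ : 0 < π / q) (h : π / p + π / q < π / 2)
    (hb : cos (π / p + π / q) = b ^ 2 * cos (π / p - π / q)) {y z t : ℝ} {k : ℤ}
    (hA : basePoint y z ∈ fibreLine (sidePoint p q b k t)) :
    (y ^ 2 + z ^ 2 - (cos (π / q) - sin (π / p)) / (cos (π / q) + sin (π / p))) *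
        (Complex.normSq (coordW (sidePoint p q b k t)) * (1 + sin (π / p + π / q))) =
      b ^ 2 * (sin (π / p + π / q) - sin (π / q - π / p)) * (1 - 2 * t) ^ 2 := by
  have hw := normSq_coordW_sidePoint_pos (b := b) hP hQ h k t
  rw [basePoint_mem_fibreLine_iff (Complex.normSq_pos.1 hw)] at hA
  have hn := congrArg Complex.normSq hA
  rw [map_mul, Complex.normSq_conj, Complex.normSq_mk, normSq_coordV_sidePoint,
    normSq_coordW_sidePoint] at hn
  have hm := inradius_sq_mul hP hQ h hb
  rw [normSq_coordW_sidePoint]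
  linear_combination (1 + sin (π / p + π / q)) * hn -
    (1 - 2 * (t * (1 - t)) * (1 - sin (π / p + π / q))) * hm

/-- No point of a side curve is closer to the origin than the foot point of the midpoint of the side
segment. -/
theorem inradius_sq_le_of_mem_sideCurve (hP : 0 < π / p) (hQ : 0 < π / q)
    (h : π / p + π / q < π / 2) (hb : cos (π / p + π / q) = b ^ 2 * cos (π / p - π / q))
    {A : ℝ × ℝ} {k : ℤ} (hA : A ∈ sideCurve p q b k) :
    (cos (π / q) - sin (π / p)) / (cos (π / q) + sin (π / p)) ≤ A.1 ^ 2 + A.2 ^ 2 := by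
  obtain ⟨-, t, -, hA⟩ := mem_sideCurve_iff.1 hA
  have hw := normSq_coordW_sidePoint_pos (b := b) hP hQ h k t
  have hs := sin_add_pos hP hQ h
  have hid := sideCurve_sub_inradius_sq hP hQ h hb hA
  have hlt := sub_pos.2 (sin_sub_lt_sin_add hP hQ h)
  rw [← sub_nonneg]
  refine nonneg_of_mul_nonneg_left ?_ (mul_pos hw (add_pos one_pos hs))
  rw [hid]
  positivity

theorem existsUnique_mem_sideCurve (hP : 0 < π / p) (hQ : 0 < π / q) (h : π / p + π / q < π / 2)
    (hb0 : b ≠ 0) (hb : cos (π / p + π / q) = b ^ 2 * cos (π / p - π / q)) (k : ℤ) :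
    ∃! A : ℝ × ℝ, A ∈ sideCurve p q b k ∧
      A.1 ^ 2 + A.2 ^ 2 = (cos (π / q) - sin (π / p)) / (cos (π / q) + sin (π / p)) := by
  have hw (t : ℝ) := normSq_coordW_sidePoint_pos (b := b) hP hQ h k t
  have hw' (t : ℝ) : coordW (sidePoint p q b k t) ≠ 0 := Complex.normSq_pos.1 (hw t)
  have hs := sin_add_pos hP hQ h
  have hlt := sub_pos.2 (sin_sub_lt_sin_add hP hQ h)
  set ζ : ℂ := coordV (sidePoint p q b k (1 / 2)) /
    starRingEnd ℂ (coordW (sidePoint p q b k (1 / 2))) with hζ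
  have hmem : basePoint ζ.re ζ.im ∈ fibreLine (sidePoint p q b k (1 / 2)) := by
    rw [basePoint_mem_fibreLine_iff (hw' _)]
    exact div_mul_cancel₀ _ ((map_ne_zero _).2 (hw' _))
  have hnorm : ζ.re ^ 2 + ζ.im ^ 2 =
      (cos (π / q) - sin (π / p)) / (cos (π / q) + sin (π / p)) := by
    have hid := sideCurve_sub_inradius_sq hP hQ h hb hmem
    rw [show (1 - 2 * (1 / 2 : ℝ)) ^ 2 = 0 by norm_num, mul_zero] at hid
    have := (mul_eq_zero.1 hid).resolve_right (mul_pos (hw _) (add_pos one_pos hs)).ne'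
    linarith
  refine ⟨(ζ.re, ζ.im), ⟨mem_sideCurve_iff.2 ⟨?_, 1 / 2, by norm_num, hmem⟩, hnorm⟩, ?_⟩
  · change ζ.re ^ 2 + ζ.im ^ 2 < 1
    rw [hnorm]
    exact (inradius_sq_mem_Ioo hP hQ h).2
  · rintro ⟨y, z⟩ ⟨hA, hyz⟩
    obtain ⟨-, t, -, hA⟩ := mem_sideCurve_iff.1 hA
    have hid := sideCurve_sub_inradius_sq hP hQ h hb hA
    rw [sub_eq_zero.2 hyz, zero_mul, eq_comm] at hid
    have hc : b ^ 2 * (sin (π / p + π / q) - sin (π / q - π / p)) ≠ 0 := by positivity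
    have ht : 1 - 2 * t = 0 := pow_eq_zero_iff two_ne_zero |>.1 ((mul_eq_zero.1 hid).resolve_left hc)
    obtain rfl : t = 1 / 2 := by linarith
    rw [basePoint_mem_fibreLine_iff (hw' _), ← eq_div_iff ((map_ne_zero _).2 (hw' _)),
      ← hζ] at hA
    rw [← hA]

/-- A disc about the origin is in the base figure if no side curve enters its interior: the
radii of the disc, without their end points, lie in the connected component of the origin. -/
theorem mem_baseFigure_of_forall_sideCurve {A : ℝ × ℝ} {s : ℝ} (hs0 : 0 < s) (hs1 : s < 1)
    (hs : ∀ k : ℤ, ∀ B ∈ sideCurve p q b k, s ≤ B.1 ^ 2 + B.2 ^ 2)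
    (hA : A.1 ^ 2 + A.2 ^ 2 ≤ s) : A ∈ baseFigure p q b := by
  set f : ℝ → ℝ × ℝ × ℝ := fun t => (t * A.1, t * A.2, 0) with hf
  have hcont : Continuous f := by fun_prop
  have hsub : f '' Set.Ico 0 1 ⊆ connectedComponentIn
      {P | P ∈ space ∧ ∀ k : ℤ, toProjective P ∉ sideSurface p q b k} (0, 0, 0) := by
    refine (isPreconnected_Ico.image f hcont.continuousOn).subset_connectedComponentIn
      ⟨0, by simp, by simp [hf]⟩ ?_
    rintro _ ⟨t, ht, rfl⟩
    have hlt : (t * A.1) ^ 2 + (t * A.2) ^ 2 < s := by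
      have h2 : t ^ 2 < 1 := pow_lt_one₀ ht.1 ht.2 two_ne_zero
      have h3 : (t * A.1) ^ 2 + (t * A.2) ^ 2 = t ^ 2 * (A.1 ^ 2 + A.2 ^ 2) := by ring
      rw [h3]
      nlinarith [sq_nonneg A.1, sq_nonneg A.2, sq_nonneg t]
    have hdisc : (t * A.1, t * A.2) ∈ basePlane := hlt.trans hs1
    refine ⟨hdisc, fun k hk => ?_⟩
    have h0 : toProjective (f t) = basePoint (t * A.1) (t * A.2) := by
      apply ext_coord <;> simp [toProjective, hf, coordW_fibreTranslation, coordV_fibreTranslation]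
    rw [h0] at hk
    exact absurd (hs k (t * A.1, t * A.2) ⟨hdisc, hk⟩) (not_le.2 hlt)
  refine ⟨hA.trans_lt hs1, closure_mono hsub (image_closure_subset_closure_image hcont ⟨1, ?_, ?_⟩)⟩
  · rw [closure_Ico zero_ne_one]
    simp
  · simp [hf]

theorem isInscribedRadius_iff (hP : 0 < π / p) (hQ : 0 < π / q) (h : π / p + π / q < π / 2)
    (hb0 : b ≠ 0) (hb : cos (π / p + π / q) = b ^ 2 * cos (π / p - π / q)) (r : ℝ) :
    IsInscribedRadius p q b r ↔
      r = artanh √((cos (π / q) - sin (π / p)) / (cos (π / q) + sin (π / p))) := by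
  have hle (k : ℤ) (B : ℝ × ℝ) (hB : B ∈ sideCurve p q b k) :=
    inradius_sq_le_of_mem_sideCurve hP hQ h hb hB
  have huniq := existsUnique_mem_sideCurve hP hQ h hb0 hb
  obtain ⟨hs0, hs1⟩ := inradius_sq_mem_Ioo hP hQ h
  set s := (cos (π / q) - sin (π / p)) / (cos (π / q) + sin (π / p))
  constructor
  · intro hr
    -- The point of the first side curve that is nearest to the origin is not in the open disc.
    obtain ⟨M, ⟨hM, hMs⟩, -⟩ := huniq 0
    obtain ⟨A, ⟨hAr, hA⟩, -⟩ := hr.touch 0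
    have h1 : r ≤ artanh √s := by
      rw [← (distOrigin_eq_artanh_sqrt hM.1 hs0.le hs1).2 hMs]
      exact not_lt.1 fun hlt => Set.disjoint_left.1 (hr.disjoint 0) ⟨hM.1, hlt⟩ hM
    have h2 : artanh √s ≤ r := by
      rw [← hAr.2, ← not_lt, distOrigin_lt_artanh_sqrt hAr.1 hs1, not_lt]
      exact hle 0 A hA
    exact le_antisymm h1 h2
  · rintro rfl
    refine ⟨artanh_pos ⟨sqrt_pos.2 hs0, ?_⟩, ?_, ?_, ?_⟩
    · rw [sqrt_lt' one_pos]
      linarith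
    · rintro A ⟨hA, hAr⟩
      exact mem_baseFigure_of_forall_sideCurve hs0 hs1 hle
        ((distOrigin_le_artanh_sqrt hA hs0.le hs1).1 hAr)
    · refine fun k => Set.disjoint_left.2 ?_
      rintro A ⟨hA, hAr⟩ hAk
      exact absurd (hle k A hAk) (not_le.2 ((distOrigin_lt_artanh_sqrt hA hs1).1 hAr))
    · intro k
      obtain ⟨M, ⟨hM, hMs⟩, hMu⟩ := huniq k
      refine ⟨M, ⟨⟨hM.1, (distOrigin_eq_artanh_sqrt hM.1 hs0.le hs1).2 hMs⟩, hM⟩, ?_⟩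
      rintro A ⟨⟨hA, hAr⟩, hAk⟩
      exact hMu A ⟨hAk, (distOrigin_eq_artanh_sqrt hA hs0.le hs1).1 hAr⟩

theorem existsUnique_isTilingPrism (hp : 3 ≤ p) (hP : 0 < π / p) (hQ : 0 < π / q)
    (h : π / p + π / q < π / 2) : ∃! b : ℝ, IsTilingPrism p q b := by
  have h1 : 0 < cos (π / p + π / q) := cos_pos_of_mem_Ioo ⟨by linarith, h⟩
  have h2 : 0 < cos (π / p - π / q) := cos_pos_of_mem_Ioo ⟨by linarith, by linarith⟩
  have h3 : cos (π / p + π / q) < cos (π / p - π / q) := by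
    rw [cos_add, cos_sub]
    have := mul_pos (sin_pos_of_pos_of_lt_pi hP (by linarith))
      (sin_pos_of_pos_of_lt_pi hQ (by linarith))
    linarith
  simp only [isTilingPrism_iff hp]
  refine ⟨√(cos (π / p + π / q) / cos (π / p - π / q)), ⟨by positivity, ?_, ?_⟩, ?_⟩
  · rwa [sqrt_lt' one_pos, one_pow, div_lt_one h2]
  · rw [sq_sqrt (by positivity), div_mul_cancel₀ _ h2.ne']
  · rintro b ⟨hb0, -, hb⟩
    rw [hb, mul_div_cancel_right₀ _ h2.ne', sqrt_sq hb0.le]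

end

end SL2R

theorem lemma4p8 (p q : ℕ) (hp : 3 ≤ p) (hq : 2 * (p : ℝ) / ((p : ℝ) - 2) < (q : ℝ)) :
    (∃! b : ℝ, SL2R.IsTilingPrism p q b) ∧
      ∀ b : ℝ, SL2R.IsTilingPrism p q b → ∀ r : ℝ, SL2R.IsInscribedRadius p q b r ↔
        r = Real.artanh √((Real.cos (Real.pi / q) - Real.sin (Real.pi / p)) /
          (Real.cos (Real.pi / q) + Real.sin (Real.pi / p))) := by
  obtain ⟨hP, hQ, h⟩ := SL2R.angle_bounds hp hq
  refine ⟨SL2R.existsUnique_isTilingPrism hp hP hQ h, fun b hb r => ?_⟩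
  obtain ⟨hb0, -, hb'⟩ := (SL2R.isTilingPrism_iff hp).1 hb
  exact SL2R.isInscribedRadius_iff hP hQ h hb0.ne' hb' r
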